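/- Let $k$ be an algebraically closed field of characteristic $0$, let $R=k[X,Y,Z,W]$ act on $\mathcal D=k[x,y,z,w]$ by partial differentiation ($X=\partial/\partial x$, etc.), and write $\mathcal D_j$ for the forms of degree $j$. A constraint $K=(K_1,\dots,K_n)$, $n\le 4$, allows a monomial when its exponent in the $l$-th variable is at most $K_l$ for $l=1,\dots,n$. Let $\mathcal M_K(d)$ be the set of multi-indices of degree $d$ allowed by $K$ and $m_K(d)$ its cardinality. **The family $G_2(a,b,i,s)$.** Let $a,b,i,s$ be integers with $b\ge a\ge 2$, $ab$ even, $i\ge ab/2+2$ and $s\ge 1$. Put $j=i+ab/2$, $P=(j,a-1,b-1)$, $Q=(1)$. Let $\mathcal E(C)=\langle f_1,\dots,f_s\rangle\subseteq\mathcal D_j$, where each $f_n$ is a linear combination, with coefficients given by $C\in k^{s\,m_P(j)}$, of the monomials in $\mathcal M_P(j)$, and let $\mathcal F(C')=\langle g\rangle$, where $g$ is the linear combination, with coefficients $C'\in k^{m_Q(j)}$, of the monomials in $\mathcal M_Q(j)$. It is required that $s$ be *$h_{\mathcal E}$-sufficient*: with $i_f=i+2$ and $e=j-i_f$, the matrix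 with rows indexed by pairs $(E,n)$, $E\in\mathcal M_P(e)$, $1\le n\le s$, and columns indexed by $D\in\mathcal M_P(i_f)$, whose entries are the coefficients of $x^D$ in $X^E*f_n$, has at least as many rows as columns. The members of $G_2(a,b,i,s)$ are the graded algebras $A=R/\mathrm{Ann}_R(\mathcal E(C)+\mathcal F(C'))$. A graded Artinian quotient $A=\bigoplus_{d\le j}A_d$ of $R$ with $A_j\neq 0$ is *level* of socle degree $j$ if $\{\alpha\in A:\alpha A_1=0\}=A_j$, and its *type* is then $\dim_k A_j$. We say that $G_2(a,b,i,s)$ *has type $t$* if, for all $(C,C')$ in some dense Zariski-open subset of $k^{s\,m_P(j)}\times k^{m_Q(j)}$, the algebra $A$ is level of socle degree $j$ and type $t$. **Theorem.** For all parameters as above, $G_2(a,b,i,s)$ has a well-defined type, and: (i) For fixed $a,b,i$, the smallest possible type (over all $h_{\mathcal E}$-sufficient $s$) is $t=1+s$, achieved by taking $$s=\left\lceil\frac{ab(2i-a-b+8)}{ab(ab-a-b)+2}\right\rceil\ \text{ if } a=2,\qquad s=\left\lceil\frac{2i-a-b+8}{ab-a-b}\right\rceil\ \text{ if } a>2.$$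 (ii) For fixed $a,b$, the smallest possible type (over all permitted $i$ and $s$) is $t=1+s$, achieved by taking $i=ab/2+2$ and $$s=\left\lceil\frac{ab(ab-a-b+12)}{ab(ab-a-b)+2}\right\rceil\ \text{ if } a=2,\qquad s=\left\lceil\frac{ab-a-b+12}{ab-a-b}\right\rceil\ \text{ if } a>2.$$ With these choices, the type is $3$ if and only if ($a\ge 2$ and $b\ge 14$) or ($a\ge 3$ and $b\ge 8$) or ($a\ge 4$ and $b\ge 6$). The smallest pairs $(a,b)$ (that is, the minimal ones in the componentwise order, among pairs with $b\ge a\ge2$ and $ab$ even) for which the type is $4$ are exactly $(2,8)$, $(3,6)$ and $(4,4)$. (iii) For any permitted $a,b,i,s$, the type is at least $3$. -/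

import Mathlib

open MvPolynomial

noncomputable section

namespace LevelAlg

/-! ### Polynomials acting as differential operators -/

section Action

variable {r : ℕ} {B : Type*} [CommRing B]

/-- The partial derivative `∂/∂x_l`, as a linear operator. -/
def partialOp (l : Fin r) : Module.End B (MvPolynomial (Fin r) B) :=
  (pderiv l : Derivation B (MvPolynomial (Fin r) B) (MvPolynomial (Fin r) B)).toLinearMap

theorem partialOp_commute (l l' : Fin r) :
    Commute (partialOp (B := B) l) (partialOp l') := by
  have h : ⁅(pderiv l : Derivation B (MvPolynomial (Fin r) B) (MvPolynomial (Fin r) B)),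
      (pderiv l' : Derivation B (MvPolynomial (Fin r) B) (MvPolynomial (Fin r) B))⁆ = 0 := by
    apply MvPolynomial.derivation_ext
    intro i
    simp only [Derivation.commutator_apply, pderiv_X, Pi.single_apply]
    split_ifs <;> simp
  refine LinearMap.ext fun f => ?_
  have := DFunLike.congr_fun h f
  simpa [partialOp, Derivation.commutator_apply, sub_eq_zero] using this

theorem partialOp_pow_commute (E E' : Fin r →₀ ℕ) :
    ((Finset.univ : Finset (Fin r)) : Set (Fin r)).Pairwise fun l l' =>
      Commute (partialOp (B := B) l ^ E l) (partialOp l' ^ E' l') :=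
  fun l _ l' _ _ => (partialOp_commute l l').pow_pow (E l) (E' l')

theorem partialOp_pow_onFun_commute (E : Fin r →₀ ℕ) :
    ((Finset.univ : Finset (Fin r)) : Set (Fin r)).Pairwise
      (Function.onFun Commute fun l => partialOp (B := B) l ^ E l) :=
  partialOp_pow_commute E E

/-- The iterated partial derivative `∂^E = ∏ l, (∂/∂x_l)^(E l)`
(the operators commute, so the order of the factors does not matter). -/
def iterDeriv (E : Fin r →₀ ℕ) : Module.End B (MvPolynomial (Fin r) B) :=
  Finset.univ.noncommProd (fun l => partialOp l ^ E l) (partialOp_pow_onFun_commute E)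

theorem iterDeriv_zero : iterDeriv (B := B) (0 : Fin r →₀ ℕ) = 1 :=
  (Finset.noncommProd_eq_pow_card _ _ _ 1 fun l _ => by simp).trans (one_pow _)

theorem iterDeriv_add (E E' : Fin r →₀ ℕ) :
    iterDeriv (B := B) (E + E') = iterDeriv E * iterDeriv E' := by
  refine Eq.trans ?_ (Finset.noncommProd_mul_distrib (s := Finset.univ)
    (fun l => partialOp (B := B) l ^ E l) (fun l => partialOp l ^ E' l)
    (partialOp_pow_onFun_commute E) (partialOp_pow_onFun_commute E')
    (partialOp_pow_commute E' E))
  exact Finset.noncommProd_congr rfl (fun l _ => by simp [pow_add]) _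

/-- The action of `R = B[X_1, …, X_r]` on `𝒟 = B[x_1, …, x_r]` by differential operators:
`X^E * f = ∂^E f`, extended linearly in the operator.  Being an algebra homomorphism into the
endomorphisms of `𝒟`, it makes `𝒟` an `R`-module. -/
def diffAct : MvPolynomial (Fin r) B →ₐ[B] Module.End B (MvPolynomial (Fin r) B) :=
  AddMonoidAlgebra.lift B (Module.End B (MvPolynomial (Fin r) B)) (Fin r →₀ ℕ)
    { toFun := fun E => iterDeriv E.toAdd
      map_one' := iterDeriv_zero
      map_mul' := fun E E' => iterDeriv_add E.toAdd E'.toAdd }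

theorem diffAct_monomial (E : Fin r →₀ ℕ) (c : B) :
    diffAct (monomial E c) = c • iterDeriv E :=
  AddMonoidAlgebra.lift_single _ _ _

end Action

/-! ### Graded quotients, socle, level algebras -/

section Level

variable {r : ℕ} {k : Type*} [Field k]

/-- `Ann_R(W) = {F ∈ R | F * f = 0 for all f ∈ W}`. -/
def annIdeal (W : Submodule k (MvPolynomial (Fin r) k)) : Ideal (MvPolynomial (Fin r) k) where
  carrier := {F | ∀ f ∈ W, diffAct F f = 0}
  add_mem' := by
    intro F G hF hG f hf
    rw [map_add, LinearMap.add_apply, hF f hf, hG f hf, add_zero]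
  zero_mem' := by
    intro f _
    rw [map_zero, LinearMap.zero_apply]
  smul_mem' := by
    intro G F hF f hf
    rw [smul_eq_mul, map_mul, Module.End.mul_apply, hF f hf, map_zero]

/-- The graded piece `A_d` of `A = R/I`: the image of the forms of degree `d`, i.e. `R_d/I_d`. -/
def gradedPiece (I : Ideal (MvPolynomial (Fin r) k)) (d : ℕ) :
    Submodule k (MvPolynomial (Fin r) k ⧸ I) :=
  (homogeneousSubmodule (Fin r) k d).map (Ideal.Quotient.mkₐ k I).toLinearMap

/-- The socle `soc(A) = {α ∈ A | α A_1 = 0}` of `A = R/I`. -/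
def socle (I : Ideal (MvPolynomial (Fin r) k)) : Submodule k (MvPolynomial (Fin r) k ⧸ I) where
  carrier := {α | ∀ β ∈ gradedPiece I 1, α * β = 0}
  add_mem' := by
    intro α α' h h' β hβ
    rw [add_mul, h β hβ, h' β hβ, add_zero]
  zero_mem' := by
    intro β _
    rw [zero_mul]
  smul_mem' := by
    intro c α h β hβ
    rw [smul_mul_assoc, h β hβ, smul_zero]

/-- `R/I` is a level algebra of socle degree `j`: `I` is homogeneous, `R/I` is Artinian, `j` is
the largest degree with `A_j ≠ 0`, and `soc(A) = A_j`. -/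
structure IsLevel (I : Ideal (MvPolynomial (Fin r) k)) (j : ℕ) : Prop where
  homogeneous : ∀ F ∈ I, ∀ d, homogeneousComponent d F ∈ I
  artinian : Module.Finite k (MvPolynomial (Fin r) k ⧸ I)
  top_ne_bot : gradedPiece I j ≠ ⊥
  eq_bot_of_gt : ∀ d, j < d → gradedPiece I d = ⊥
  socle_eq : socle I = gradedPiece I j

/-- The type `dim_k A_j` of a level algebra `A = R/I` of socle degree `j`. -/
def levelType (I : Ideal (MvPolynomial (Fin r) k)) (j : ℕ) : ℕ :=
  Module.finrank k (gradedPiece I j)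

end Level

/-! ### "For general `C`" -/

section General

variable {k : Type*} [Field k] {ι : Type*}

/-- `U ⊆ k^ι` is Zariski-open: its complement is the common zero locus of a set of polynomials. -/
def IsZariskiOpen (U : Set (ι → k)) : Prop :=
  ∃ S : Set (MvPolynomial ι k), U = {c | ∃ p ∈ S, eval c p ≠ 0}

/-- `U ⊆ k^ι` is Zariski-dense: it meets every nonempty Zariski-open set. -/
def IsZariskiDense (U : Set (ι → k)) : Prop :=
  ∀ V : Set (ι → k), IsZariskiOpen V → V.Nonempty → (U ∩ V).Nonempty

/-- `p C` holds for general `C ∈ k^ι`: it holds on some dense Zariski-open subset. -/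
def ForGeneral (p : (ι → k) → Prop) : Prop :=
  ∃ U : Set (ι → k), IsZariskiOpen U ∧ IsZariskiDense U ∧ ∀ c ∈ U, p c

end General

/-! ### Constrained multi-indices and families of subspaces -/

section Constraint

/-- A multi-index `D` is constrained by `K = (K_1, …, K_n)` if `D_l ≤ K_l` for `l = 1, …, n`;
the remaining coordinates are free. -/
def Constrained {r : ℕ} (K : List ℕ) (D : Fin r →₀ ℕ) : Prop :=
  ∀ (l : Fin r) (h : (l : ℕ) < K.length), D l ≤ K[(l : ℕ)]

open Classical in
/-- `ℳ_K(d)`: the multi-indices of dimension `r` and degree `d` constrained by `K`. -/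
def multiIdx (r : ℕ) (K : List ℕ) (d : ℕ) : Finset (Fin r →₀ ℕ) :=
  ((Finset.univ : Finset (Fin r)).finsuppAntidiag d).filter fun D => Constrained K D

/-- Coefficients of `s` polynomials in the span of the monomials `x^J`, `J ∈ ℳ_K(j)`:
a coefficient is indexed by a pair `(n, J)`. -/
abbrev CoeffIdx (r : ℕ) (K : List ℕ) (j s : ℕ) : Type := Fin s × multiIdx r K j

variable {r j s : ℕ} {K : List ℕ} {B : Type*} [CommRing B]

/-- The polynomial `f_n(C) = ∑_{J ∈ ℳ_K(j)} C_{n,J} x^J`. -/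
def generator (C : CoeffIdx r K j s → B) (n : Fin s) : MvPolynomial (Fin r) B :=
  ∑ J : multiIdx r K j, monomial (J : Fin r →₀ ℕ) (C (n, J))

/-- The subspace `⟨f_1(C), …, f_s(C)⟩` of `𝒟_j`. -/
def spanOf {k : Type*} [Field k] (C : CoeffIdx r K j s → k) :
    Submodule k (MvPolynomial (Fin r) k) :=
  Submodule.span k (Set.range (generator C))

/-- The `e`-th cropped matrix (`d` being `j - e`) of the family `⟨f_1, …, f_s⟩` whose coefficients
`z_{n,J}` are indeterminates: rows are indexed by the pairs `(E, n)` with `E ∈ ℳ_K(e)`, columns by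
`D ∈ ℳ_K(d)`, and the entry is the coefficient of `x^D` in `X^E * f_n`. -/
def croppedMatrix (k : Type*) [Field k] (r : ℕ) (K : List ℕ) (j s e d : ℕ) :
    Matrix (multiIdx r K e × Fin s) (multiIdx r K d) (MvPolynomial (CoeffIdx r K j s) k) :=
  Matrix.of fun En D =>
    coeff (D : Fin r →₀ ℕ)
      (diffAct (monomial (En.1 : Fin r →₀ ℕ) 1)
        (generator (fun nJ : CoeffIdx r K j s => (X nJ : MvPolynomial _ k)) En.2))

/-- A matrix has at least as many rows as columns. -/
def ColsLeRows {m n α : Type*} [Fintype m] [Fintype n] (_M : Matrix m n α) : Prop :=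
  Fintype.card n ≤ Fintype.card m

end Constraint

/-! ### The family `G₂(a, b, i, s)` -/

section G2

/-- The requirements `b ≥ a ≥ 2` and `ab` even on `a, b`. -/
def G2AdmissibleAB (a b : ℕ) : Prop := 2 ≤ a ∧ a ≤ b ∧ Even (a * b)

/-- The requirements on `a, b, i`: moreover `i ≥ ab/2 + 2`. -/
def G2AdmissibleABI (a b i : ℕ) : Prop := G2AdmissibleAB a b ∧ a * b / 2 + 2 ≤ i

/-- The socle degree `j = i + ab/2`. -/
def g2SocleDegree (a b i : ℕ) : ℕ := i + a * b / 2

/-- The first constraint `P = (j, a - 1, b - 1)`. -/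
def g2P (a b i : ℕ) : List ℕ := [g2SocleDegree a b i, a - 1, b - 1]

/-- The second constraint `Q = (1)`. -/
def g2Q : List ℕ := [1]

/-- `s` is `h_ℰ`-sufficient: with `i_f = i + 2`, the `(j - i_f)`-th cropped matrix of `ℰ` has at
least as many rows as columns. -/
def G2Sufficient (k : Type*) [Field k] (a b i s : ℕ) : Prop :=
  ColsLeRows (croppedMatrix k 4 (g2P a b i) (g2SocleDegree a b i) s
    (g2SocleDegree a b i - (i + 2)) (i + 2))

/-- `(a, b, i, s)` are parameters of the family `G₂`. -/
def G2Params (k : Type*) [Field k] (a b i s : ℕ) : Prop :=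
  G2AdmissibleABI a b i ∧ 0 < s ∧ G2Sufficient k a b i s

/-- Index set of the coordinates of a pair `(C, C')`, where `C` holds the coefficients of the `s`
generators of `ℰ` and `C'` those of the `u = 1` generator of `ℱ`. -/
abbrev G2CoeffIdx (a b i s : ℕ) : Type :=
  CoeffIdx 4 (g2P a b i) (g2SocleDegree a b i) s ⊕ CoeffIdx 4 g2Q (g2SocleDegree a b i) 1

/-- The ideal `Ann_R(ℰ(C) + ℱ(C'))` defining the member of `G₂(a, b, i, s)` at `(C, C')`. -/
def g2Ideal {k : Type*} [Field k] {a b i s : ℕ} (c : G2CoeffIdx a b i s → k) :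
    Ideal (MvPolynomial (Fin 4) k) :=
  annIdeal (spanOf (fun x => c (Sum.inl x)) ⊔ spanOf (fun x => c (Sum.inr x)))

/-- `G₂(a, b, i, s)` has type `t`: for general `(C, C')`, the algebra `R/Ann_R(ℰ(C) + ℱ(C'))` is
level of socle degree `j` and has type `t`. -/
def G2HasType (k : Type*) [Field k] (a b i s t : ℕ) : Prop :=
  ForGeneral fun c : G2CoeffIdx a b i s → k =>
    IsLevel (g2Ideal c) (g2SocleDegree a b i) ∧
      levelType (g2Ideal c) (g2SocleDegree a b i) = t

/-- The explicit value of `s` attached to `a, b, i`; all arithmetic is in `ℚ`. -/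
def g2OptS (a b i : ℕ) : ℕ :=
  if a = 2 then
    ⌈((a * b * (2 * i - a - b + 8) : ℚ) / (a * b * (a * b - a - b) + 2))⌉₊
  else
    ⌈((2 * i - a - b + 8 : ℚ) / (a * b - a - b))⌉₊

/-- The explicit value of `s` attached to `a, b`; all arithmetic is in `ℚ`. -/
def g2OptSAB (a b : ℕ) : ℕ :=
  if a = 2 then
    ⌈((a * b * (a * b - a - b + 12) : ℚ) / (a * b * (a * b - a - b) + 2))⌉₊
  else
    ⌈((a * b - a - b + 12 : ℚ) / (a * b - a - b))⌉₊

end G2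

end LevelAlg

end

/-! Macaulay duality reduces the type to a dimension. For a nonzero space `W` of forms of degree `j`
in characteristic zero, `R/Ann(W)` is level of socle degree `j`, and differentiation pairs its top
piece perfectly with `W`, so its type is `dim W` (`isLevel_annIdeal`,
`finrank_gradedPiece_annIdeal`).

For general coefficients `ℰ` has dimension `min(s, m_P(j))`. The form `g` contains `y^j`, which `P`
forbids, so `ℱ` adds one dimension. Hence the type is `min(s, m_P(j)) + 1` (`g2HasType_min`), and it
is unique because two dense open sets meet.

With `e = j - (i+2) = ab/2 - 2`, sufficiency says `m_P(i+2) ≤ s · m_P(e)`. Counting gives `2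
m_P(i+2) = ab(2i+8-a-b)` and `2 m_P(e) = ab(ab-a-b)`, plus `2` when `a = 2`. The least sufficient
`s` is therefore the stated ceiling (`g2Sufficient_iff`). It never exceeds `m_P(j)`, so the minimum
in the type formula is harmless. The ceiling increases with `i`, hence is smallest at `i = ab/2 +
2`; what remains is elementary inequalities in `a` and `b`. -/

namespace LevelAlg

/-! ### Degrees under the differentiation action -/

section Action

variable {r : ℕ} {B : Type*} [CommRing B]

theorem iterDeriv_single (l : Fin r) (n : ℕ) :
    iterDeriv (B := B) (Finsupp.single l n) = partialOp l ^ n := by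
  refine (Finset.mul_noncommProd_erase Finset.univ (Finset.mem_univ l) _
    (partialOp_pow_onFun_commute _)).symm.trans ?_
  refine (congrArg _ (Finset.noncommProd_eq_pow_card _ _ _ 1 fun x hx => ?_)).trans ?_
  · rw [Finsupp.single_eq_of_ne (Finset.ne_of_mem_erase hx), pow_zero]
  · rw [Finsupp.single_eq_same, one_pow, mul_one]

theorem diffAct_X (l : Fin r) :
    diffAct (X l : MvPolynomial (Fin r) B) = partialOp l := by
  rw [X, diffAct_monomial, iterDeriv_single, pow_one, one_smul]

theorem diffAct_X_apply (l : Fin r) (f : MvPolynomial (Fin r) B) :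
    diffAct (X l) f = pderiv l f := by
  rw [diffAct_X]; rfl

theorem isHomogeneous_iterDeriv (E : Fin r →₀ ℕ) :
    ∀ (n : ℕ) (f : MvPolynomial (Fin r) B), f.IsHomogeneous n →
      (iterDeriv E f).IsHomogeneous (n - E.degree) := by
  induction E using Finsupp.induction_linear with
  | zero => intro n f hf; simpa [iterDeriv_zero] using hf
  | add E E' h h' =>
    intro n f hf
    rw [iterDeriv_add, Module.End.mul_apply, map_add, add_comm, ← Nat.sub_sub]
    exact h _ _ (h' _ _ hf)
  | single l m =>
    rw [iterDeriv_single, Finsupp.degree_single]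
    induction m with
    | zero => intro n f hf; simpa using hf
    | succ m ih =>
      intro n f hf
      rw [pow_succ', Module.End.mul_apply, ← Nat.sub_sub]
      exact (ih n f hf).pderiv

/-- Complements `isHomogeneous_iterDeriv`, whose truncated degree `n - E.degree` carries too little
information once the order of the operator exceeds `n`. -/
theorem iterDeriv_eq_zero (E : Fin r →₀ ℕ) :
    ∀ (n : ℕ) (f : MvPolynomial (Fin r) B), f.IsHomogeneous n → n < E.degree →
      iterDeriv E f = 0 := by
  induction E using Finsupp.induction_linear with
  | zero => intro n f hf h; simp at h
  | add E E' h h' =>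
    intro n f hf hn
    rw [iterDeriv_add, Module.End.mul_apply]
    rw [map_add] at hn
    by_cases h1 : n < E'.degree
    · rw [h' _ _ hf h1, map_zero]
    · exact h _ _ (isHomogeneous_iterDeriv _ _ _ hf) (by omega)
  | single l m =>
    rw [iterDeriv_single, Finsupp.degree_single]
    induction m with
    | zero => intro n f hf h; simp at h
    | succ m ih =>
      intro n f hf h
      rw [pow_succ', Module.End.mul_apply]
      by_cases h1 : n < m
      · rw [ih n f hf h1, map_zero]
      · have h2 := isHomogeneous_iterDeriv (Finsupp.single l m) n f hf
        rw [iterDeriv_single, Finsupp.degree_single, show n - m = 0 by omega] at h2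
        rw [totalDegree_eq_zero_iff_eq_C.mp (Nat.le_zero.mp h2.totalDegree_le)]
        exact pderiv_C

theorem isHomogeneous_diffAct {F f : MvPolynomial (Fin r) B} {d n : ℕ}
    (hF : F.IsHomogeneous d) (hf : f.IsHomogeneous n) :
    (diffAct F f).IsHomogeneous (n - d) := by
  rw [F.as_sum, map_sum, LinearMap.sum_apply]
  refine IsHomogeneous.sum _ _ _ fun E hE => ?_
  rw [diffAct_monomial, LinearMap.smul_apply]
  have hd : E.degree = d := by
    rw [Finsupp.degree_eq_weight_one]; exact hF (mem_support_iff.mp hE)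
  exact (homogeneousSubmodule (Fin r) B _).smul_mem _ (hd ▸ isHomogeneous_iterDeriv E n f hf)

theorem diffAct_eq_zero_of_lt {F f : MvPolynomial (Fin r) B} {d n : ℕ}
    (hF : F.IsHomogeneous d) (hf : f.IsHomogeneous n) (h : n < d) :
    diffAct F f = 0 := by
  rw [F.as_sum, map_sum, LinearMap.sum_apply]
  refine Finset.sum_eq_zero fun E hE => ?_
  have hd : E.degree = d := by
    rw [Finsupp.degree_eq_weight_one]; exact hF (mem_support_iff.mp hE)
  rw [diffAct_monomial, LinearMap.smul_apply, iterDeriv_eq_zero E n f hf (hd ▸ h), smul_zero]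

/-- Components of `F` of distinct degrees at most `n` send `f` to distinct degrees, and those of
degree above `n` kill it, so nothing else lands in degree `n - d`. -/
theorem homogeneousComponent_diffAct {F f : MvPolynomial (Fin r) B} {d n : ℕ}
    (hf : f.IsHomogeneous n) (h : d ≤ n) :
    homogeneousComponent (n - d) (diffAct F f) = diffAct (homogeneousComponent d F) f := by
  conv_lhs => rw [← F.sum_homogeneousComponent]
  rw [map_sum, LinearMap.sum_apply, map_sum]
  have key : ∀ e, homogeneousComponent (n - d) (diffAct (homogeneousComponent e F) f) =
      if e = d then diffAct (homogeneousComponent d F) f else 0 := by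
    intro e
    have he := homogeneousComponent_isHomogeneous e F
    by_cases h1 : n < e
    · rw [diffAct_eq_zero_of_lt he hf h1, map_zero, if_neg (by omega)]
    · rw [homogeneousComponent_of_mem (isHomogeneous_diffAct he hf)]
      by_cases h2 : e = d
      · subst h2; simp
      · rw [if_neg h2, if_neg (by omega)]
  rw [Finset.sum_congr rfl fun e _ => key e, Finset.sum_ite_eq']
  split_ifs with h2
  · rfl
  · rw [homogeneousComponent_eq_zero, map_zero, LinearMap.zero_apply]
    simpa using h2

end Action

/-! ### Macaulay duality: level algebras from spaces of forms -/

section Level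

variable {r : ℕ} {k : Type*} [Field k]

theorem mem_annIdeal {W : Submodule k (MvPolynomial (Fin r) k)} {F : MvPolynomial (Fin r) k} :
    F ∈ annIdeal W ↔ ∀ f ∈ W, diffAct F f = 0 := Iff.rfl

theorem mem_gradedPiece {I : Ideal (MvPolynomial (Fin r) k)} {d : ℕ}
    {α : MvPolynomial (Fin r) k ⧸ I} :
    α ∈ gradedPiece I d ↔ ∃ F : MvPolynomial (Fin r) k, F.IsHomogeneous d ∧
      Ideal.Quotient.mk I F = α := Iff.rfl

theorem eq_C_of_pderiv_eq_zero [CharZero k] {f : MvPolynomial (Fin r) k}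
    (h : ∀ l, pderiv l f = 0) : f = C (coeff 0 f) := by
  classical
  ext E
  rw [coeff_C]
  split_ifs with hE
  · rw [hE]
  · obtain ⟨l, hl⟩ := Finsupp.ne_iff.mp (Ne.symm hE)
    have hle : Finsupp.single l 1 ≤ E := by
      rw [Finsupp.single_le_iff]; exact Nat.one_le_iff_ne_zero.mpr hl
    have h1 := coeff_pderiv (i := l) f (E - Finsupp.single l 1)
    rw [h l, coeff_zero, tsub_add_cancel_of_le hle] at h1
    exact (mul_eq_zero.mp h1.symm).resolve_right (Nat.cast_add_one_ne_zero _)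

theorem homogeneousComponent_eq_zero_of_pderiv [CharZero k] {f : MvPolynomial (Fin r) k} {n : ℕ}
    (hn : n ≠ 0) (h : ∀ l, pderiv l f = 0) : homogeneousComponent n f = 0 := by
  rw [eq_C_of_pderiv_eq_zero h, homogeneousComponent_of_mem (isHomogeneous_C _ _), if_neg hn]

/-- The pairing between forms of degree `n` is nondegenerate on the side of `𝒟`. -/
theorem eq_zero_of_forall_diffAct [CharZero k] {n : ℕ} :
    ∀ {f : MvPolynomial (Fin r) k}, f.IsHomogeneous n →
      (∀ F : MvPolynomial (Fin r) k, F.IsHomogeneous n → diffAct F f = 0) → f = 0 := by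
  induction n with
  | zero =>
    intro f _ h
    simpa using h 1 (isHomogeneous_one _ _)
  | succ n ih =>
    intro f hf h
    rw [← homogeneousComponent_eq_self hf]
    -- Every partial derivative of `f` pairs to zero with all forms of degree `n`, since `F * (X_l *
    -- f) = (F X_l) * f`; the induction hypothesis kills it.
    refine homogeneousComponent_eq_zero_of_pderiv n.succ_ne_zero fun l =>
      ih hf.pderiv fun F hF => ?_
    rw [← diffAct_X_apply, ← Module.End.mul_apply, ← map_mul]
    exact h _ (hF.mul (isHomogeneous_X _ _))

variable {W : Submodule k (MvPolynomial (Fin r) k)} {j : ℕ}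

theorem homogeneousComponent_mem_annIdeal (hW : W ≤ homogeneousSubmodule (Fin r) k j)
    {F : MvPolynomial (Fin r) k} (hF : F ∈ annIdeal W) (d : ℕ) :
    homogeneousComponent d F ∈ annIdeal W := by
  intro f hf
  have hf' : f.IsHomogeneous j := hW hf
  by_cases h : d ≤ j
  · rw [← homogeneousComponent_diffAct hf' h, hF f hf, map_zero]
  · exact diffAct_eq_zero_of_lt (homogeneousComponent_isHomogeneous d F) hf' (by omega)

theorem mem_annIdeal_of_lt (hW : W ≤ homogeneousSubmodule (Fin r) k j)
    {F : MvPolynomial (Fin r) k} {d : ℕ} (hF : F.IsHomogeneous d) (h : j < d) :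
    F ∈ annIdeal W :=
  fun _ hf => diffAct_eq_zero_of_lt hF (hW hf) h

theorem mem_of_forall_homogeneousComponent_mem {I : Ideal (MvPolynomial (Fin r) k)}
    {F : MvPolynomial (Fin r) k} (h : ∀ d, homogeneousComponent d F ∈ I) : F ∈ I := by
  rw [← F.sum_homogeneousComponent]
  exact Submodule.sum_mem _ fun d _ => h d

theorem finite_quotient_annIdeal (hW : W ≤ homogeneousSubmodule (Fin r) k j) :
    Module.Finite k (MvPolynomial (Fin r) k ⧸ annIdeal W) := by
  refine Module.Finite.of_surjective
    ((Ideal.Quotient.mkₐ k (annIdeal W)).toLinearMap ∘ₗ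
      (restrictTotalDegree (Fin r) k j).subtype) fun α => ?_
  obtain ⟨F, rfl⟩ := Ideal.Quotient.mk_surjective α
  refine ⟨⟨∑ d ∈ Finset.range (j + 1), homogeneousComponent d F, ?_⟩, ?_⟩
  · refine Submodule.sum_mem _ fun d hd => ?_
    rw [mem_restrictTotalDegree]
    have := (homogeneousComponent_isHomogeneous d F).totalDegree_le
    have := Finset.mem_range.mp hd
    omega
  · change Ideal.Quotient.mk _ _ = Ideal.Quotient.mk _ _
    refine Ideal.Quotient.eq.mpr (mem_of_forall_homogeneousComponent_mem fun d => ?_)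
    by_cases h : d ≤ j
    · change homogeneousComponent d (∑ e ∈ Finset.range (j + 1), homogeneousComponent e F - F) ∈ _
      rw [map_sub, map_sum, Finset.sum_congr rfl fun e _ =>
        homogeneousComponent_of_mem (homogeneousComponent_isHomogeneous e F),
        Finset.sum_ite_eq, if_pos (Finset.mem_range.mpr (by omega)), sub_self]
      exact Submodule.zero_mem _
    · exact mem_annIdeal_of_lt hW (homogeneousComponent_isHomogeneous d _) (by omega)

/-- The pairing `(F, f) ↦ F * f` of `R_j` with `W` takes constant values. It induces a map `R_j →
W*` whose kernel is the degree `j` part of the annihilator, and which is onto because no nonzero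
form is killed by all of `R_j`. -/
theorem finrank_gradedPiece_annIdeal [CharZero k]
    (hW : W ≤ homogeneousSubmodule (Fin r) k j) [FiniteDimensional k W] :
    Module.finrank k (gradedPiece (annIdeal W) j) = Module.finrank k W := by
  let R := homogeneousSubmodule (Fin r) k j
  let p : R →ₗ[k] Module.Dual k W :=
    LinearMap.mk₂ k (fun (F : R) (f : W) => coeff 0 (diffAct F.1 f.1))
      (by intros; simp) (by intros; simp) (by intros; simp) (by intros; simp)
  let q : R →ₗ[k] MvPolynomial (Fin r) k ⧸ annIdeal W :=
    (Ideal.Quotient.mkₐ k (annIdeal W)).toLinearMap ∘ₗ R.subtype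
  have hconst : ∀ (F : R) (f : W), diffAct F.1 f.1 = C (coeff 0 (diffAct F.1 f.1)) := by
    intro F f
    have := isHomogeneous_diffAct F.2 (hW f.2)
    rw [Nat.sub_self] at this
    exact totalDegree_eq_zero_iff_eq_C.mp (Nat.le_zero.mp this.totalDegree_le)
  have hker : LinearMap.ker q = LinearMap.ker p := by
    ext F
    rw [LinearMap.mem_ker, LinearMap.mem_ker]
    change Ideal.Quotient.mk _ _ = 0 ↔ _
    rw [Ideal.Quotient.eq_zero_iff_mem, mem_annIdeal]
    constructor
    · intro h
      ext f
      change coeff 0 (diffAct F.1 f.1) = 0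
      exact (congrArg (coeff 0) (h f.1 f.2)).trans (coeff_zero _)
    · intro h f hf
      have : p F ⟨f, hf⟩ = 0 := by rw [h]; rfl
      exact (hconst F ⟨f, hf⟩).trans ((congrArg C this).trans C_0)
  have hsurj : Function.Surjective p := by
    rw [← LinearMap.flip_injective_iff₂, injective_iff_map_eq_zero]
    intro f hf
    refine Subtype.ext (eq_zero_of_forall_diffAct (hW f.2) fun F hF => ?_)
    rw [hconst ⟨F, hF⟩ f]
    have : p.flip f ⟨F, hF⟩ = 0 := by rw [hf]; rfl
    change C (p.flip f ⟨F, hF⟩) = 0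
    rw [this, C_0]
  have hrange : gradedPiece (annIdeal W) j = LinearMap.range q := by
    rw [LinearMap.range_comp, Submodule.range_subtype]; rfl
  rw [hrange, ← q.quotKerEquivRange.finrank_eq, hker, p.quotKerEquivRange.finrank_eq,
    LinearMap.range_eq_top.mpr hsurj, finrank_top, Subspace.dual_finrank_eq]

/-- In characteristic zero the annihilator of any nonzero space of forms of degree `j` defines a
level algebra of socle degree `j`. -/
theorem isLevel_annIdeal [CharZero k] (hW : W ≤ homogeneousSubmodule (Fin r) k j)
    [FiniteDimensional k W] (hne : W ≠ ⊥) : IsLevel (annIdeal W) j where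
  homogeneous F hF d := homogeneousComponent_mem_annIdeal hW hF d
  artinian := finite_quotient_annIdeal hW
  top_ne_bot h := by
    have := finrank_gradedPiece_annIdeal hW
    rw [h, finrank_bot, eq_comm, Submodule.finrank_eq_zero] at this
    exact hne this
  eq_bot_of_gt d hd := by
    rw [eq_bot_iff]
    rintro α hα
    obtain ⟨F, hF, rfl⟩ := mem_gradedPiece.mp hα
    exact Ideal.Quotient.eq_zero_iff_mem.mpr (mem_annIdeal_of_lt hW hF hd)
  socle_eq := by
    refine le_antisymm (fun α hα => ?_) fun α hα β hβ => ?_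
    · obtain ⟨F, rfl⟩ := Ideal.Quotient.mk_surjective α
      have hX : ∀ l, F * X l ∈ annIdeal W := fun l => by
        rw [← Ideal.Quotient.eq_zero_iff_mem, map_mul]
        exact hα _ (mem_gradedPiece.mpr ⟨X l, isHomogeneous_X _ _, rfl⟩)
      -- For `d < j`: all partial derivatives of `F * f` vanish, so `F * f` is constant and its
      -- component of positive degree `j - d` is zero.
      have hlow : ∀ d ≠ j, homogeneousComponent d F ∈ annIdeal W := by
        intro d hd
        rcases lt_or_gt_of_ne hd with h | h
        · intro f hf
          rw [← homogeneousComponent_diffAct (hW hf) h.le]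
          refine homogeneousComponent_eq_zero_of_pderiv (by omega) fun l => ?_
          rw [← diffAct_X_apply, ← Module.End.mul_apply, ← map_mul, mul_comm]
          exact hX l f hf
        · exact mem_annIdeal_of_lt hW (homogeneousComponent_isHomogeneous d F) h
      refine mem_gradedPiece.mpr
        ⟨homogeneousComponent j F, homogeneousComponent_isHomogeneous j F, ?_⟩
      refine Ideal.Quotient.eq.mpr (mem_of_forall_homogeneousComponent_mem fun d => ?_)
      rw [map_sub, homogeneousComponent_of_mem (homogeneousComponent_isHomogeneous j F)]
      split_ifs with h
      · rw [h, sub_self]; exact Submodule.zero_mem _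
      · exact Submodule.sub_mem _ (Submodule.zero_mem _) (hlow d h)
    · obtain ⟨F, hF, rfl⟩ := mem_gradedPiece.mp hα
      obtain ⟨G, hG, rfl⟩ := mem_gradedPiece.mp hβ
      rw [← map_mul, Ideal.Quotient.eq_zero_iff_mem]
      exact mem_annIdeal_of_lt hW (hF.mul hG) (Nat.lt_succ_self j)

end Level

/-! ### General points -/

section Zariski

variable {k : Type*} [Field k] {ι : Type*}

theorem isZariskiOpen_eval_ne_zero (p : MvPolynomial ι k) :
    IsZariskiOpen {c | eval c p ≠ 0} :=
  ⟨{p}, by simp⟩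

theorem isZariskiDense_eval_ne_zero [Infinite k] {p : MvPolynomial ι k} (hp : p ≠ 0) :
    IsZariskiDense {c | eval c p ≠ 0} := by
  rintro V ⟨S, rfl⟩ ⟨c, q, hq, hc⟩
  have hq0 : q ≠ 0 := by rintro rfl; simp at hc
  obtain ⟨x, hx⟩ := not_forall.mp (mt MvPolynomial.funext_iff.mpr (mul_ne_zero hp hq0))
  rw [map_mul, map_zero] at hx
  exact ⟨x, left_ne_zero_of_mul hx, q, hq, right_ne_zero_of_mul hx⟩

theorem ForGeneral.of_eval_ne_zero [Infinite k] {P : (ι → k) → Prop} (p : MvPolynomial ι k)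
    (c₀ : ι → k) (h₀ : eval c₀ p ≠ 0) (h : ∀ c, eval c p ≠ 0 → P c) : ForGeneral P :=
  ⟨_, isZariskiOpen_eval_ne_zero p,
    isZariskiDense_eval_ne_zero (by rintro rfl; simp at h₀), h⟩

/-- A dense set meets every nonempty open set. This is what makes the type unique. -/
theorem ForGeneral.exists_and {P Q : (ι → k) → Prop} (hP : ForGeneral P) (hQ : ForGeneral Q) :
    ∃ c, P c ∧ Q c := by
  obtain ⟨U, _, hU, hUP⟩ := hP
  obtain ⟨V, hVo, hV, hVQ⟩ := hQ
  have hne : V.Nonempty := by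
    obtain ⟨x, hx, _⟩ := hV Set.univ ⟨{1}, by simp⟩ Set.univ_nonempty
    exact ⟨x, hx⟩
  obtain ⟨x, hx, hx'⟩ := hU V hVo hne
  exact ⟨x, hUP x hx, hVQ x hx'⟩

end Zariski

/-! ### Dimension of the spans of the generators -/

section Span

variable {r j s : ℕ} {K : List ℕ}

theorem mem_multiIdx {d : ℕ} {D : Fin r →₀ ℕ} :
    D ∈ multiIdx r K d ↔ D.degree = d ∧ Constrained K D := by
  simp [multiIdx, Finsupp.degree_eq_sum]

theorem coeff_generator_of_notMem {B : Type*} [CommRing B] (C : CoeffIdx r K j s → B) (n : Fin s)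
    {J : Fin r →₀ ℕ} (h : J ∉ multiIdx r K j) : coeff J (generator C n) = 0 := by
  classical
  rw [generator, coeff_sum]
  refine Finset.sum_eq_zero fun J' _ => ?_
  rw [coeff_monomial, if_neg]
  rintro rfl
  exact h J'.2

theorem coeff_generator {B : Type*} [CommRing B] (C : CoeffIdx r K j s → B) (n : Fin s)
    (J : multiIdx r K j) : coeff (J : Fin r →₀ ℕ) (generator C n) = C (n, J) := by
  classical
  rw [generator, coeff_sum, Finset.sum_eq_single J]
  · simp
  · intro J' _ hJ
    rw [coeff_monomial, if_neg fun h => hJ (Subtype.ext h)]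
  · simp

theorem isHomogeneous_generator {B : Type*} [CommRing B] (C : CoeffIdx r K j s → B) (n : Fin s) :
    (generator C n).IsHomogeneous j :=
  IsHomogeneous.sum _ _ _ fun J _ => isHomogeneous_monomial _ (mem_multiIdx.mp J.2).1

variable {k : Type*} [Field k]

theorem spanOf_le_homogeneousSubmodule (C : CoeffIdx r K j s → k) :
    spanOf C ≤ homogeneousSubmodule (Fin r) k j :=
  Submodule.span_le.mpr <| by rintro _ ⟨n, rfl⟩; exact isHomogeneous_generator C n

instance (C : CoeffIdx r K j s → k) : FiniteDimensional k (spanOf C) :=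
  FiniteDimensional.span_of_finite k (Set.finite_range _)

theorem coeff_eq_zero_of_mem_spanOf (C : CoeffIdx r K j s → k) {J : Fin r →₀ ℕ}
    (h : J ∉ multiIdx r K j) {f : MvPolynomial (Fin r) k} (hf : f ∈ spanOf C) :
    coeff J f = 0 := by
  have : spanOf C ≤ LinearMap.ker (lcoeff k J) :=
    Submodule.span_le.mpr <| by rintro _ ⟨n, rfl⟩; exact coeff_generator_of_notMem C n h
  exact this hf

theorem finrank_spanOf (C : CoeffIdx r K j s → k) :
    Module.finrank k (spanOf C) = (Matrix.of fun n J => C (n, J)).rank := by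
  let φ : (multiIdx r K j → k) →ₗ[k] MvPolynomial (Fin r) k :=
    ∑ J : multiIdx r K j, (monomial (J : Fin r →₀ ℕ)) ∘ₗ LinearMap.proj J
  have hφ : ∀ v, φ v = generator (s := 1) (fun nJ => v nJ.2) 0 := fun v => by
    simp [φ, generator]
  have hinj : Function.Injective φ := by
    intro v w hvw
    ext J
    have := congrArg (coeff (J : Fin r →₀ ℕ)) hvw
    rwa [hφ, hφ, coeff_generator, coeff_generator] at this
  rw [Matrix.rank_eq_finrank_span_row, (Submodule.equivMapOfInjective φ hinj _).finrank_eq,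
    Submodule.map_span, ← Set.range_comp]
  have : φ ∘ (Matrix.of fun n J => C (n, J)).row = generator C := by
    funext n
    exact (hφ _).trans (by simp [generator, Matrix.row])
  rw [this, spanOf]

/-- A nonzero minor bounds the rank below by its size, here the largest size possible. This turns
full rank into a polynomial condition. -/
theorem rank_eq_of_det_submatrix_ne_zero {m n : Type*} [Fintype m] [Fintype n] {t : ℕ}
    (A : Matrix m n k) (hm : t = min (Fintype.card m) (Fintype.card n)) (u : Fin t → m)
    (v : Fin t → n) (h : (A.submatrix u v).det ≠ 0) : A.rank = t := by
  refine le_antisymm (hm ▸ le_min A.rank_le_card_height A.rank_le_card_width) ?_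
  have h1 := Matrix.rank_of_isUnit (A.submatrix u v)
    ((Matrix.isUnit_iff_isUnit_det _).mpr (isUnit_iff_ne_zero.mpr h))
  rw [Fintype.card_fin] at h1
  exact h1.symm.le.trans (A.rank_submatrix_le u v)

theorem finrank_spanOf_eq_of_det_ne_zero (C : CoeffIdx r K j s → k) {t : ℕ}
    (ht : t = min s (multiIdx r K j).card) (u : Fin t → Fin s) (v : Fin t → multiIdx r K j)
    (h : ((Matrix.of fun n J => C (n, J)).submatrix u v).det ≠ 0) :
    Module.finrank k (spanOf C) = t := by
  rw [finrank_spanOf]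
  exact rank_eq_of_det_submatrix_ne_zero _
    (by rw [ht, Fintype.card_fin, Fintype.card_coe]) u v h

/-- The coefficient at `J` vanishes on the first span but not on the single generator of the second,
so the two spans meet only in zero. -/
theorem finrank_sup_spanOf (C : CoeffIdx r K j s → k) {K' : List ℕ} (C' : CoeffIdx r K' j 1 → k)
    (J : multiIdx r K' j) (hJ : (J : Fin r →₀ ℕ) ∉ multiIdx r K j) (h : C' (0, J) ≠ 0) :
    Module.finrank k ↥(spanOf C ⊔ spanOf C') = Module.finrank k (spanOf C) + 1 := by
  have hspan : spanOf C' = Submodule.span k {generator C' 0} := by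
    rw [spanOf, Set.range_unique]; rfl
  have hne : generator C' 0 ≠ 0 := fun h0 => h <| by
    rw [← coeff_generator C' 0 J, h0, coeff_zero]
  have hdisj : spanOf C ⊓ spanOf C' = ⊥ := by
    rw [eq_bot_iff, hspan]
    rintro f ⟨hf, hf'⟩
    obtain ⟨a, rfl⟩ := Submodule.mem_span_singleton.mp hf'
    have h1 := coeff_eq_zero_of_mem_spanOf C hJ hf
    rw [coeff_smul, coeff_generator, smul_eq_mul] at h1
    rw [(mul_eq_zero.mp h1).resolve_right h, zero_smul]
    exact Submodule.zero_mem _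
  have := Submodule.finrank_sup_add_finrank_inf_eq (spanOf C) (spanOf C')
  rw [hdisj, finrank_bot, add_zero] at this
  rw [this, hspan, finrank_span_singleton hne]

theorem levelType_annIdeal [CharZero k] {W : Submodule k (MvPolynomial (Fin r) k)} {t : ℕ}
    (hW : W ≤ homogeneousSubmodule (Fin r) k j) [FiniteDimensional k W]
    (h : Module.finrank k W = t + 1) :
    IsLevel (annIdeal W) j ∧ levelType (annIdeal W) j = t + 1 := by
  refine ⟨isLevel_annIdeal hW ?_, (finrank_gradedPiece_annIdeal hW).trans h⟩
  rintro rfl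
  rw [finrank_bot] at h
  exact absurd h.symm (Nat.succ_ne_zero t)

end Span

/-! ### The type of a general member -/

section GeneralType

variable {k : Type*} [Field k] {a b i s : ℕ}

theorem exists_mem_multiIdx_g2Q (ha : a ≤ g2SocleDegree a b i) (ha' : 0 < a) :
    ∃ J ∈ multiIdx 4 g2Q (g2SocleDegree a b i),
      J ∉ multiIdx 4 (g2P a b i) (g2SocleDegree a b i) := by
  -- The monomial `y^j`: `Q` bounds only the exponent of `x`, while `P` requires the exponent of `y`
  -- to be below `a ≤ j`.
  refine ⟨Finsupp.single 1 (g2SocleDegree a b i), ?_, fun h => ?_⟩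
  · refine mem_multiIdx.mpr ⟨Finsupp.degree_single _ _, fun l hl => ?_⟩
    have : l = 0 := by ext; simpa [g2Q] using hl
    subst this
    simp
  · have := (mem_multiIdx.mp h).2 1 (by simp [g2P])
    simp [g2P] at this
    omega

theorem g2HasType_min [CharZero k] (ha : a ≤ g2SocleDegree a b i) (ha' : 0 < a) :
    G2HasType k a b i s
      (min s (multiIdx 4 (g2P a b i) (g2SocleDegree a b i)).card + 1) := by
  obtain ⟨J, hJ, hJ'⟩ := exists_mem_multiIdx_g2Q (b := b) (i := i) ha ha'
  set M := multiIdx 4 (g2P a b i) (g2SocleDegree a b i) with hM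
  set t := min s M.card
  let u : Fin t ↪ Fin s := Fin.castLEEmb (min_le_left _ _)
  let v : Fin t ↪ M := (Fin.castLEEmb (min_le_right _ _)).trans M.equivFin.symm.toEmbedding
  let N : Matrix (Fin t) (Fin t) (MvPolynomial (G2CoeffIdx a b i s) k) :=
    Matrix.of fun x y => X (Sum.inl (u x, v y))
  -- The open set is where a maximal minor of the coefficients of `ℰ` times one coefficient of `g`
  -- is nonzero; at `c₀` that minor is the determinant of the identity.
  let c₀ : G2CoeffIdx a b i s → k := Sum.elim
    (fun nJ => if ∃ x, u x = nJ.1 ∧ v x = nJ.2 then 1 else 0) fun _ => 1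
  have hev : ∀ c : G2CoeffIdx a b i s → k, eval c (N.det * X (Sum.inr (0, ⟨J, hJ⟩))) =
      ((Matrix.of fun n J => c (Sum.inl (n, J))).submatrix u v).det *
        c (Sum.inr (0, ⟨J, hJ⟩)) := by
    intro c
    rw [map_mul, eval_X, RingHom.map_det]
    congr 2
    ext x y
    simp [N]
  refine ForGeneral.of_eval_ne_zero (N.det * X (Sum.inr (0, ⟨J, hJ⟩))) c₀ ?_ fun c hc => ?_
  · have : (Matrix.of fun n J => c₀ (Sum.inl (n, J))).submatrix u v = 1 := by
      ext x y
      simp [c₀, Matrix.one_apply]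
    rw [hev, this, Matrix.det_one, one_mul]
    exact one_ne_zero
  · rw [hev] at hc
    have h1 := left_ne_zero_of_mul hc
    have h2 := right_ne_zero_of_mul hc
    refine levelType_annIdeal (sup_le (spanOf_le_homogeneousSubmodule _)
      (spanOf_le_homogeneousSubmodule _)) ?_
    rw [finrank_sup_spanOf _ _ ⟨J, hJ⟩ hJ' h2, finrank_spanOf_eq_of_det_ne_zero _ rfl u v h1]

theorem G2HasType.unique {t t' : ℕ} (h : G2HasType k a b i s t) (h' : G2HasType k a b i s t') :
    t = t' := by
  obtain ⟨c, hc, hc'⟩ := h.exists_and h'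
  exact hc.2.symm.trans hc'.2

end GeneralType

/-! ### Counting constrained monomials -/

section Count

theorem card_multiIdx_g2P {a b i d : ℕ} (ha : 0 < a) (hb : 0 < b) (hd : d ≤ g2SocleDegree a b i) :
    (multiIdx 4 (g2P a b i) d).card =
      ∑ y ∈ Finset.range a, ∑ z ∈ Finset.range b, (d + 1 - y - z) := by
  have hmem : ∀ D : Fin 4 →₀ ℕ, D ∈ multiIdx 4 (g2P a b i) d ↔
      D 0 + D 1 + D 2 + D 3 = d ∧ D 1 < a ∧ D 2 < b := by
    intro D
    rw [mem_multiIdx, Finsupp.degree_eq_sum, Fin.sum_univ_four]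
    refine and_congr_right fun h => ⟨fun hD => ⟨?_, ?_⟩, fun hD l hl => ?_⟩
    · have := hD 1 (by simp [g2P]); simp [g2P] at this; omega
    · have := hD 2 (by simp [g2P]); simp [g2P] at this; omega
    · fin_cases l
      · simp [g2P]; omega
      · simp [g2P]; omega
      · simp [g2P]; omega
      · simp [g2P] at hl
  rw [← Finset.sum_product' (Finset.range a) (Finset.range b) fun y z => d + 1 - y - z]
  have hT : ∑ p ∈ Finset.range a ×ˢ Finset.range b, (d + 1 - p.1 - p.2) =
      ((Finset.range a ×ˢ Finset.range b).sigma fun p => Finset.range (d + 1 - p.1 - p.2)).card := by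
    rw [Finset.card_sigma]; simp
  rw [hT]
  -- The free exponent of `w` is determined by the degree, and the bound `j` on the exponent of `x`
  -- is vacuous since `d ≤ j`.
  refine Finset.card_bij' (fun D _ => ⟨(D 1, D 2), D 0⟩)
    (fun q _ => Finsupp.equivFunOnFinite.symm
      ![q.2, q.1.1, q.1.2, d - q.2 - q.1.1 - q.1.2]) ?_ ?_ ?_ ?_
  · intro D hD
    have := (hmem D).mp hD
    simp only [Finset.mem_sigma, Finset.mem_product, Finset.mem_range]
    omega
  · rintro ⟨⟨y, z⟩, x⟩ hq
    simp only [Finset.mem_sigma, Finset.mem_product, Finset.mem_range] at hq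
    rw [hmem]
    simp
    omega
  · intro D hD
    have := (hmem D).mp hD
    ext l
    fin_cases l
    · simp
    · simp
    · simp
    · simp; omega
  · rintro ⟨⟨y, z⟩, x⟩ _
    simp

theorem two_mul_sum_range_sub (b : ℕ) (c : ℤ) :
    2 * ∑ z ∈ Finset.range b, (c - z) = b * (2 * c + 1 - b) := by
  induction b with
  | zero => simp
  | succ b ih => rw [Finset.sum_range_succ, mul_add, ih]; push_cast; ring

theorem two_mul_sum_sum_range_sub (a b : ℕ) (c : ℤ) :
    2 * ∑ y ∈ Finset.range a, ∑ z ∈ Finset.range b, (c - y - z) =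
      a * b * (2 * c + 2 - a - b) := by
  induction a with
  | zero => simp
  | succ a ih =>
    rw [Finset.sum_range_succ, mul_add, ih, two_mul_sum_range_sub]; push_cast; ring

/-- Since `y + z ≤ a + b - 2`, the bound `h` is exactly what keeps every `d + 1 - y - z`
nonnegative, so truncated subtraction agrees with the integer one. -/
theorem two_mul_card_multiIdx_g2P {a b i d : ℕ} (ha : 0 < a) (hb : 0 < b)
    (hd : d ≤ g2SocleDegree a b i) (h : a + b ≤ d + 3) :
    (2 * (multiIdx 4 (g2P a b i) d).card : ℤ) = a * b * (2 * d + 4 - a - b) := by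
  rw [card_multiIdx_g2P ha hb hd, show (2 * d + 4 - a - b : ℤ) = 2 * (d + 1) + 2 - a - b by ring,
    ← two_mul_sum_sum_range_sub]
  push_cast
  congr 1
  refine Finset.sum_congr rfl fun y hy => Finset.sum_congr rfl fun z hz => ?_
  rw [Finset.mem_range] at hy hz
  omega

/-- Just outside the range of the general formula: the single term `y = 1`, `z = c + 1` is `-1`
before truncation. This is the source of the `+ 2` in the denominator for `a = 2`. -/
theorem card_multiIdx_g2P_two {c i : ℕ} (hd : c ≤ g2SocleDegree 2 (c + 2) i) :
    (multiIdx 4 (g2P 2 (c + 2) i) c).card = (c + 1) ^ 2 := by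
  rw [card_multiIdx_g2P two_pos (Nat.succ_pos _) hd]
  change ∑ y ∈ Finset.range (1 + 1), ∑ z ∈ Finset.range (c + 1 + 1), (c + 1 - y - z) = _
  rw [Finset.sum_range_succ, Finset.sum_range_one,
    Finset.sum_range_succ (fun z => c + 1 - 1 - z), Finset.sum_range_succ (fun z => c + 1 - 1 - z)]
  have h1 : ∀ n : ℕ, (2 * (∑ z ∈ Finset.range n, (n - z) : ℕ) : ℤ) = n * (n + 1) := by
    intro n
    have := two_mul_sum_range_sub n n
    rw [show (n * (n + 1) : ℤ) = n * (2 * n + 1 - n) by ring, ← this]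
    push_cast
    congr 1
    refine Finset.sum_congr rfl fun z hz => ?_
    rw [Finset.mem_range] at hz
    omega
  have h2 := h1 c
  have h3 := h1 (c + 1)
  rw [Finset.sum_range_succ]
  simp only [Nat.add_sub_cancel, Nat.sub_zero, Nat.sub_self, Nat.add_zero] at h3 ⊢
  zify
  push_cast at h2 h3
  have h4 : c - (c + 1) = 0 := by omega
  rw [h4]
  push_cast
  linarith

end Count

/-! ### Sufficiency and the numerical inequalities -/

section Parameters

variable {a b i s : ℕ}

theorem G2AdmissibleAB.two_mul_half (h : G2AdmissibleAB a b) : 2 * (a * b / 2) = a * b :=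
  Nat.mul_div_cancel' h.2.2.two_dvd

/-- Amounts to `(a - 2)(b - 2) ≥ 0`; it places the degrees `i + 2` and `j` in the range of the
closed count. -/
theorem G2AdmissibleABI.add_le (h : G2AdmissibleABI a b i) : a + b + 2 ≤ i + 2 := by
  obtain ⟨hab, hi⟩ := h
  have h2 := hab.two_mul_half
  obtain ⟨ha, hb, -⟩ := hab
  nlinarith [Nat.mul_le_mul ha (ha.trans hb)]

theorem two_mul_card_free (h : G2AdmissibleABI a b i) :
    (2 * (multiIdx 4 (g2P a b i) (i + 2)).card : ℤ) = a * b * (2 * i + 8 - a - b) := by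
  have h1 := h.add_le
  obtain ⟨hab, hi⟩ := h
  have h2 := hab.two_mul_half
  obtain ⟨ha, hb, -⟩ := hab
  have h4 := Nat.mul_le_mul ha (ha.trans hb)
  rw [two_mul_card_multiIdx_g2P (by omega) (by omega)
    (by rw [g2SocleDegree]; omega) (by omega)]
  push_cast; ring

theorem two_mul_card_socle (h : G2AdmissibleABI a b i) :
    (2 * (multiIdx 4 (g2P a b i) (g2SocleDegree a b i)).card : ℤ) =
      a * b * (2 * i + a * b + 4 - a - b) := by
  have h1 := h.add_le
  obtain ⟨hab, hi⟩ := h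
  have h2 := hab.two_mul_half
  obtain ⟨ha, hb, -⟩ := hab
  have h4 := Nat.mul_le_mul ha (ha.trans hb)
  rw [two_mul_card_multiIdx_g2P (by omega) (by omega) le_rfl (by rw [g2SocleDegree]; omega),
    g2SocleDegree]
  zify at h2
  push_cast
  linear_combination (a * b : ℤ) * h2

theorem socleDegree_sub (h : G2AdmissibleABI a b i) :
    2 * (g2SocleDegree a b i - (i + 2)) + 4 = a * b := by
  obtain ⟨hab, hi⟩ := h
  have h2 := hab.two_mul_half
  have h4 := Nat.mul_le_mul hab.1 (hab.1.trans hab.2.1)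
  rw [g2SocleDegree]; omega

theorem two_mul_card_shift_two (h : G2AdmissibleABI 2 b i) :
    (2 * (multiIdx 4 (g2P 2 b i) (g2SocleDegree 2 b i - (i + 2))).card : ℤ) =
      2 * b * (2 * b - 2 - b) + 2 := by
  have h1 := socleDegree_sub h
  obtain ⟨c, rfl⟩ := Nat.exists_eq_add_of_le' h.1.2.1
  have h2 : g2SocleDegree 2 (c + 2) i - (i + 2) = c := by omega
  rw [h2, card_multiIdx_g2P_two (by omega)]
  push_cast; ring

theorem two_mul_card_shift (h : G2AdmissibleABI a b i) (ha : a ≠ 2) :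
    (2 * (multiIdx 4 (g2P a b i) (g2SocleDegree a b i - (i + 2))).card : ℤ) =
      a * b * (a * b - a - b) := by
  have h1 := socleDegree_sub h
  obtain ⟨⟨ha2, hb, hev⟩, -⟩ := h
  have h3 : 3 ≤ a := by omega
  have hb4 : 4 ≤ b := by
    by_contra hlt
    obtain rfl : a = 3 := by omega
    obtain rfl : b = 3 := by omega
    exact absurd hev (by decide)
  have h5 : a + b ≤ g2SocleDegree a b i - (i + 2) + 3 := by
    -- Equivalent to `(a - 2)(b - 2) ≥ 2`, which would fail only at `(3, 3)`, excluded by parity.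
    have : 2 * a + 2 * b ≤ a * b + 2 := by nlinarith
    omega
  rw [two_mul_card_multiIdx_g2P (by omega) (by omega) (Nat.sub_le _ _) h5]
  zify at h1
  rw [← h1]

theorem g2Sufficient_iff_card (k : Type*) [Field k] :
    G2Sufficient k a b i s ↔ (multiIdx 4 (g2P a b i) (i + 2)).card ≤
      (multiIdx 4 (g2P a b i) (g2SocleDegree a b i - (i + 2))).card * s := by
  unfold G2Sufficient ColsLeRows
  rw [Fintype.card_prod, Fintype.card_coe, Fintype.card_coe, Fintype.card_fin]

theorem g2OptS_two_le_iff (hb : 2 ≤ b) :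
    g2OptS 2 b i ≤ s ↔
      (2 * b * (2 * i + 8 - 2 - b) : ℤ) ≤ s * (2 * b * (2 * b - 2 - b) + 2) := by
  have hpos : (0 : ℚ) < 2 * b * (2 * b - 2 - b) + 2 := by
    have : (2 : ℚ) ≤ b := by exact_mod_cast hb
    nlinarith
  rw [g2OptS, if_pos rfl, Nat.ceil_le, ← Int.cast_le (R := ℚ)]
  push_cast
  rw [div_le_iff₀ hpos, show (2 * i - 2 - b + 8 : ℚ) = 2 * i + 8 - 2 - b by ring]

theorem g2OptS_le_iff (h : G2AdmissibleAB a b) (ha : a ≠ 2) :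
    g2OptS a b i ≤ s ↔ (2 * i + 8 - a - b : ℤ) ≤ s * (a * b - a - b) := by
  obtain ⟨ha2, hb, -⟩ := h
  have h3 : 3 ≤ a := by omega
  have hpos : (0 : ℚ) < a * b - a - b := by
    have h3' : (3 : ℚ) ≤ a := by exact_mod_cast h3
    have hb' : (a : ℚ) ≤ b := by exact_mod_cast hb
    nlinarith
  rw [g2OptS, if_neg ha, Nat.ceil_le, ← Int.cast_le (R := ℚ)]
  push_cast
  rw [div_le_iff₀ hpos, show (2 * i - a - b + 8 : ℚ) = 2 * i + 8 - a - b by ring]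

/-- The counting inequality is linear in `s` with positive slope, so its solutions start at a
ceiling. For `a > 2` the common factor `ab` cancels; for `a = 2` the correction `+ 2` prevents this.
-/
theorem g2Sufficient_iff (k : Type*) [Field k] (h : G2AdmissibleABI a b i) :
    G2Sufficient k a b i s ↔ g2OptS a b i ≤ s := by
  rw [g2Sufficient_iff_card]
  have hf := two_mul_card_free h
  by_cases ha : a = 2
  · subst ha
    rw [g2OptS_two_le_iff h.1.2.1, ← two_mul_card_shift_two h]
    zify
    push_cast at hf
    rw [← hf, ← mul_le_mul_iff_right₀ (two_pos (α := ℤ))]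
    ring_nf
  · rw [g2OptS_le_iff h.1 ha]
    have he := two_mul_card_shift h ha
    have hpos : (0 : ℤ) < a * b := by
      have := h.1.1
      have := h.1.2.1
      exact_mod_cast Nat.mul_pos (by omega) (by omega)
    rw [← mul_le_mul_iff_right₀ hpos, ← hf,
      show (a * b * (s * (a * b - a - b)) : ℤ) = a * b * (a * b - a - b) * s by ring, ← he]
    zify
    rw [← mul_le_mul_iff_right₀ (two_pos (α := ℤ)), mul_assoc]

theorem g2OptS_mono {i' : ℕ} (h : G2AdmissibleAB a b) (hi : i ≤ i') :
    g2OptS a b i ≤ g2OptS a b i' := by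
  have hi' : (i : ℤ) ≤ i' := by exact_mod_cast hi
  by_cases ha : a = 2
  · subst ha
    rw [g2OptS_two_le_iff h.2.1]
    refine le_trans ?_ ((g2OptS_two_le_iff h.2.1).mp le_rfl)
    gcongr
  · rw [g2OptS_le_iff h ha]
    refine le_trans ?_ ((g2OptS_le_iff h ha).mp le_rfl)
    gcongr

theorem g2OptSAB_eq (h : G2AdmissibleAB a b) : g2OptSAB a b = g2OptS a b (a * b / 2 + 2) := by
  have h2 : (2 * ((a * b / 2 + 2 : ℕ) : ℚ)) = a * b + 4 := by
    have := h.two_mul_half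
    exact_mod_cast (by omega : 2 * (a * b / 2 + 2) = a * b + 4)
  unfold g2OptSAB g2OptS
  rw [h2, show (a * b + 4 - a - b + 8 : ℚ) = a * b - a - b + 12 by ring]

theorem g2OptSAB_two_le_iff (h : G2AdmissibleAB 2 b) :
    g2OptSAB 2 b ≤ s ↔ (b * (b + 10) : ℤ) ≤ s * (b * (b - 2) + 1) := by
  have h2 := h.two_mul_half
  rw [g2OptSAB_eq h, g2OptS_two_le_iff h.2.1]
  zify at h2
  push_cast
  rw [mul_add, h2, ← mul_le_mul_iff_right₀ (two_pos (α := ℤ))]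
  ring_nf
  constructor <;> intro <;> linarith

theorem g2OptSAB_le_iff (h : G2AdmissibleAB a b) (ha : a ≠ 2) :
    g2OptSAB a b ≤ s ↔ (a * b - a - b + 12 : ℤ) ≤ s * (a * b - a - b) := by
  have h2 := h.two_mul_half
  rw [g2OptSAB_eq h, g2OptS_le_iff h ha]
  zify at h2
  push_cast
  rw [mul_add, h2]
  ring_nf

/-- The fraction under the ceiling is greater than one. -/
theorem two_le_g2OptSAB (h : G2AdmissibleAB a b) : 2 ≤ g2OptSAB a b := by
  by_contra hlt
  have h1 : g2OptSAB a b ≤ 1 := by omega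
  by_cases ha : a = 2
  · subst ha
    rw [g2OptSAB_two_le_iff h] at h1
    have hb : (2 : ℤ) ≤ b := by exact_mod_cast h.2.1
    push_cast at h1
    nlinarith
  · rw [g2OptSAB_le_iff h ha] at h1
    push_cast at h1
    linarith

theorem g2OptSAB_le_g2OptS (h : G2AdmissibleABI a b i) : g2OptSAB a b ≤ g2OptS a b i := by
  rw [g2OptSAB_eq h.1]
  exact g2OptS_mono h.1 h.2

theorem g2OptS_le_card_socle (h : G2AdmissibleABI a b i) :
    g2OptS a b i ≤ (multiIdx 4 (g2P a b i) (g2SocleDegree a b i)).card := by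
  -- It is enough that `s = m_P(j)` is sufficient, which follows from `m_P(i+2) ≤ m_P(j)` and
  -- `m_P(e) ≥ 1`. Sufficiency does not depend on the field, so `ℚ` serves.
  rw [← g2Sufficient_iff ℚ h, g2Sufficient_iff_card]
  have hf := two_mul_card_free h
  have hj := two_mul_card_socle h
  have h4 : (4 : ℤ) ≤ a * b := by
    exact_mod_cast Nat.mul_le_mul h.1.1 (h.1.1.trans h.1.2.1)
  have hle : (multiIdx 4 (g2P a b i) (i + 2)).card ≤
      (multiIdx 4 (g2P a b i) (g2SocleDegree a b i)).card := by
    zify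
    nlinarith
  refine hle.trans (Nat.le_mul_of_pos_left _ ?_)
  by_cases ha : a = 2
  · subst ha
    have he := two_mul_card_shift_two h
    have hb : (2 : ℤ) ≤ b := by exact_mod_cast h.1.2.1
    zify
    nlinarith
  · have he := two_mul_card_shift h ha
    have h3 : (3 : ℤ) ≤ a := by have := h.1.1; exact_mod_cast (by omega : 3 ≤ a)
    have hb : (a : ℤ) ≤ b := by exact_mod_cast h.1.2.1
    have : (0 : ℤ) < a * b * (a * b - a - b) := mul_pos (by linarith) (by nlinarith)
    zify
    linarith

/-- For `a > 2` the condition is `(a - 1)(b - 1) ≥ 13`; for `a = 2` it is `b² - 14b + 2 ≥ 0`. Parity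
removes `(5, 5)`. -/
theorem g2OptSAB_le_two_iff (h : G2AdmissibleAB a b) :
    g2OptSAB a b ≤ 2 ↔ (2 ≤ a ∧ 14 ≤ b) ∨ (3 ≤ a ∧ 8 ≤ b) ∨ (4 ≤ a ∧ 6 ≤ b) := by
  by_cases ha : a = 2
  · subst ha
    rw [g2OptSAB_two_le_iff h]
    constructor
    · intro h1
      push_cast at h1
      by_contra h2
      have hb : b ≤ 13 := by omega
      have hb2 := h.2.1
      interval_cases b <;> norm_num at h1
    · intro h1
      have hb : 14 ≤ b := by omega
      zify at hb
      push_cast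
      nlinarith
  · rw [g2OptSAB_le_iff h ha]
    obtain ⟨ha2, hb, hev⟩ := h
    constructor
    · intro h1
      push_cast at h1
      by_contra h2
      have hb7 : b ≤ 7 := by omega
      have ha7 : a ≤ 7 := by omega
      interval_cases b <;> interval_cases a <;>
        first | omega | (revert hev; decide)
    · intro h1
      have h2 : (3 ≤ a ∧ 8 ≤ b) ∨ (4 ≤ a ∧ 6 ≤ b) := by omega
      rcases h2 with ⟨h3, h4⟩ | ⟨h3, h4⟩ <;> zify at h3 h4 <;> push_cast <;> nlinarith

/-- For `a > 2` the condition is `(a - 1)(b - 1) ≥ 7`; for `a = 2` it is `2b² - 16b + 3 ≥ 0`. Parity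
removes `(3, 5)`. -/
theorem g2OptSAB_le_three_iff (h : G2AdmissibleAB a b) :
    g2OptSAB a b ≤ 3 ↔ 8 ≤ b ∨ (3 ≤ a ∧ 6 ≤ b) ∨ 4 ≤ a := by
  by_cases ha : a = 2
  · subst ha
    rw [g2OptSAB_two_le_iff h]
    constructor
    · intro h1
      push_cast at h1
      by_contra h2
      have hb : b ≤ 7 := by omega
      have hb2 := h.2.1
      interval_cases b <;> norm_num at h1
    · intro h1
      have hb : 8 ≤ b := by omega
      zify at hb
      push_cast
      nlinarith
  · rw [g2OptSAB_le_iff h ha]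
    obtain ⟨ha2, hb, hev⟩ := h
    constructor
    · intro h1
      push_cast at h1
      by_contra h2
      have hb7 : b ≤ 7 := by omega
      have ha7 : a ≤ 3 := by omega
      interval_cases b <;> interval_cases a <;>
        first | omega | (revert hev; decide)
    · intro h1
      have h2 : (3 ≤ a ∧ 6 ≤ b) ∨ (4 ≤ a ∧ 4 ≤ b) := by omega
      rcases h2 with ⟨h3, h4⟩ | ⟨h3, h4⟩ <;> zify at h3 h4 <;> push_cast <;> nlinarith

theorem g2OptSAB_eq_three_iff (h : G2AdmissibleAB a b) :
    g2OptSAB a b = 3 ↔ (a = 2 ∧ 8 ≤ b ∧ b ≤ 13) ∨ (a = 3 ∧ b = 6) ∨ (a = 4 ∧ (b = 4 ∨ b = 5)) := by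
  have h2 := g2OptSAB_le_two_iff h
  have h3 := g2OptSAB_le_three_iff h
  rw [show g2OptSAB a b = 3 ↔ g2OptSAB a b ≤ 3 ∧ ¬ g2OptSAB a b ≤ 2 by omega, h2, h3]
  obtain ⟨ha2, hb, hev⟩ := h
  constructor
  · intro h1
    have h55 : ¬ (a = 5 ∧ b = 5) := by rintro ⟨rfl, rfl⟩; exact absurd hev (by decide)
    have h37 : ¬ (a = 3 ∧ b = 7) := by rintro ⟨rfl, rfl⟩; exact absurd hev (by decide)
    omega
  · omega

end Parameters

/-! ### Smallest types and minimal pairs -/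

section MainResults

variable {k : Type*} [Field k] [CharZero k] {a b i s t : ℕ}

theorem g2HasType_iff (h : G2AdmissibleABI a b i) :
    G2HasType k a b i s t ↔
      t = min s (multiIdx 4 (g2P a b i) (g2SocleDegree a b i)).card + 1 := by
  have hmin : G2HasType k a b i s
      (min s (multiIdx 4 (g2P a b i) (g2SocleDegree a b i)).card + 1) := by
    have := h.add_le
    have := h.1.1
    exact g2HasType_min (by rw [g2SocleDegree]; omega) (by omega)
  exact ⟨fun ht => ht.unique hmin, fun ht => ht ▸ hmin⟩

theorem g2HasType_g2OptS_iff (h : G2AdmissibleABI a b i) :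
    G2HasType k a b i (g2OptS a b i) t ↔ t = 1 + g2OptS a b i := by
  rw [g2HasType_iff h, min_eq_left (g2OptS_le_card_socle h), add_comm]

theorem g2Params_g2OptS (k : Type*) [Field k] (h : G2AdmissibleABI a b i) :
    G2Params k a b i (g2OptS a b i) :=
  ⟨h, two_pos.trans_le ((two_le_g2OptSAB h.1).trans (g2OptSAB_le_g2OptS h)),
    (g2Sufficient_iff k h).mpr le_rfl⟩

theorem g2OptS_add_one_le (h : G2Params k a b i s) (ht : G2HasType k a b i s t) :
    1 + g2OptS a b i ≤ t := by
  rw [(g2HasType_iff h.1).mp ht, add_comm]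
  exact Nat.succ_le_succ (le_min ((g2Sufficient_iff k h.1).mp h.2.2) (g2OptS_le_card_socle h.1))

theorem G2AdmissibleAB.admissibleABI (h : G2AdmissibleAB a b) :
    G2AdmissibleABI a b (a * b / 2 + 2) := ⟨h, le_rfl⟩

theorem g2HasType_g2OptSAB_iff (h : G2AdmissibleAB a b) :
    G2HasType k a b (a * b / 2 + 2) (g2OptSAB a b) t ↔ t = 1 + g2OptSAB a b := by
  rw [g2OptSAB_eq h, g2HasType_g2OptS_iff h.admissibleABI]

theorem g2Params_g2OptSAB (k : Type*) [Field k] (h : G2AdmissibleAB a b) :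
    G2Params k a b (a * b / 2 + 2) (g2OptSAB a b) := by
  rw [g2OptSAB_eq h]
  exact g2Params_g2OptS k h.admissibleABI

theorem g2OptSAB_add_one_le (h : G2Params k a b i s) (ht : G2HasType k a b i s t) :
    1 + g2OptSAB a b ≤ t :=
  (Nat.add_le_add_left (g2OptSAB_le_g2OptS h.1) 1).trans (g2OptS_add_one_le h ht)

theorem admissible_and_g2HasType_four_iff (q : ℕ × ℕ) :
    (G2AdmissibleAB q.1 q.2 ∧
      G2HasType k q.1 q.2 (q.1 * q.2 / 2 + 2) (g2OptSAB q.1 q.2) 4) ↔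
      (q.1 = 2 ∧ 8 ≤ q.2 ∧ q.2 ≤ 13) ∨ (q.1 = 3 ∧ q.2 = 6) ∨
        (q.1 = 4 ∧ (q.2 = 4 ∨ q.2 = 5)) := by
  have key : G2AdmissibleAB q.1 q.2 → (G2HasType k q.1 q.2 (q.1 * q.2 / 2 + 2)
      (g2OptSAB q.1 q.2) 4 ↔ (q.1 = 2 ∧ 8 ≤ q.2 ∧ q.2 ≤ 13) ∨ (q.1 = 3 ∧ q.2 = 6) ∨
        (q.1 = 4 ∧ (q.2 = 4 ∨ q.2 = 5))) := fun h => by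
    rw [g2HasType_g2OptSAB_iff h, ← g2OptSAB_eq_three_iff h]
    omega
  refine ⟨fun h => (key h.1).mp h.2, fun h => ?_⟩
  have hadm : G2AdmissibleAB q.1 q.2 := by
    refine ⟨by omega, by omega, ?_⟩
    rw [Nat.even_mul]
    rcases h with ⟨h, -⟩ | ⟨-, h⟩ | ⟨h, -⟩
    · left; rw [h]; decide
    · right; rw [h]; decide
    · left; rw [h]; decide
  exact ⟨hadm, (key hadm).mpr h⟩

theorem minimal_type_four_iff (p : ℕ × ℕ) :
    Minimal (fun q : ℕ × ℕ => G2AdmissibleAB q.1 q.2 ∧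
      G2HasType k q.1 q.2 (q.1 * q.2 / 2 + 2) (g2OptSAB q.1 q.2) 4) p ↔
    p = (2, 8) ∨ p = (3, 6) ∨ p = (4, 4) := by
  simp only [admissible_and_g2HasType_four_iff]
  obtain ⟨x, y⟩ := p
  simp only [Minimal, Prod.forall, Prod.mk_le_mk, Prod.mk.injEq]
  constructor
  · rintro ⟨h, hmin⟩
    -- The pairs of type 4 are `(2, 8), …, (2, 13)`, `(3, 6)`, `(4, 4)` and `(4, 5)`; comparison
    -- with `(2, 8)` and `(4, 4)` eliminates all the non-minimal ones.
    have h1 := hmin 2 8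
    have h2 := hmin 4 4
    omega
  · intro h
    refine ⟨by omega, fun u v _ _ => by omega⟩

end MainResults

end LevelAlg

theorem mainTheorem11 (k : Type*) [Field k] [IsAlgClosed k] [CharZero k] :
    -- every member of the family has a well-defined type
    (∀ a b i s : ℕ, LevelAlg.G2Params k a b i s → ∃ t, LevelAlg.G2HasType k a b i s t) ∧
    -- (i) the smallest type for fixed `a, b, i`
    (∀ a b i : ℕ, LevelAlg.G2AdmissibleABI a b i →
      LevelAlg.G2Params k a b i (LevelAlg.g2OptS a b i) ∧
      LevelAlg.G2HasType k a b i (LevelAlg.g2OptS a b i) (1 + LevelAlg.g2OptS a b i) ∧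
      IsLeast {t | ∃ s, LevelAlg.G2Params k a b i s ∧ LevelAlg.G2HasType k a b i s t}
        (1 + LevelAlg.g2OptS a b i)) ∧
    -- (ii) the smallest type for fixed `a, b`
    (∀ a b : ℕ, LevelAlg.G2AdmissibleAB a b →
      LevelAlg.G2Params k a b (a * b / 2 + 2) (LevelAlg.g2OptSAB a b) ∧
      LevelAlg.G2HasType k a b (a * b / 2 + 2) (LevelAlg.g2OptSAB a b)
        (1 + LevelAlg.g2OptSAB a b) ∧
      IsLeast {t | ∃ i s, LevelAlg.G2Params k a b i s ∧ LevelAlg.G2HasType k a b i s t}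
        (1 + LevelAlg.g2OptSAB a b)) ∧
    -- (ii) for these choices of `i` and `s`: when the type is 3
    (∀ a b : ℕ, LevelAlg.G2AdmissibleAB a b →
      (LevelAlg.G2HasType k a b (a * b / 2 + 2) (LevelAlg.g2OptSAB a b) 3 ↔
        (2 ≤ a ∧ 14 ≤ b) ∨ (3 ≤ a ∧ 8 ≤ b) ∨ (4 ≤ a ∧ 6 ≤ b))) ∧
    -- (ii) the smallest `(a, b)`, in the componentwise order, for which the type is 4
    (∀ p : ℕ × ℕ,
      Minimal (fun q : ℕ × ℕ => LevelAlg.G2AdmissibleAB q.1 q.2 ∧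
        LevelAlg.G2HasType k q.1 q.2 (q.1 * q.2 / 2 + 2) (LevelAlg.g2OptSAB q.1 q.2) 4) p ↔
      p = (2, 8) ∨ p = (3, 6) ∨ p = (4, 4)) ∧
    -- (iii) the type is always at least 3
    (∀ a b i s t : ℕ, LevelAlg.G2Params k a b i s → LevelAlg.G2HasType k a b i s t → 3 ≤ t) := by
  refine ⟨fun a b i s h => ⟨_, (LevelAlg.g2HasType_iff h.1).mpr rfl⟩, fun a b i h => ?_,
    fun a b h => ?_, fun a b h => ?_, LevelAlg.minimal_type_four_iff, fun a b i s t h ht => ?_⟩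
  · have hP := LevelAlg.g2Params_g2OptS k h
    have hT := (LevelAlg.g2HasType_g2OptS_iff (k := k) h).mpr rfl
    exact ⟨hP, hT, ⟨_, hP, hT⟩, fun t ⟨_, hs, ht⟩ => LevelAlg.g2OptS_add_one_le hs ht⟩
  · have hP := LevelAlg.g2Params_g2OptSAB k h
    have hT := (LevelAlg.g2HasType_g2OptSAB_iff (k := k) h).mpr rfl
    exact ⟨hP, hT, ⟨_, _, hP, hT⟩, fun t ⟨_, _, hs, ht⟩ => LevelAlg.g2OptSAB_add_one_le hs ht⟩
  · have h2 := LevelAlg.two_le_g2OptSAB h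
    rw [LevelAlg.g2HasType_g2OptSAB_iff h, ← LevelAlg.g2OptSAB_le_two_iff h]
    omega
  · have h2 := LevelAlg.two_le_g2OptSAB h.1.1
    have h3 := LevelAlg.g2OptSAB_add_one_le h ht
    omega
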